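/- Let $\mathbb K$ be a field of characteristic zero, let $w=(w_1,\dots,w_n)$ be integers with $1\le w_1\le\dots\le w_n$, and write $\langle w,\alpha\rangle=\sum_j w_j\alpha_j$ for $\alpha\in\mathbb N^n$. A formal vector field is a $\mathbb K$-linear derivation $X=\sum_i X^i\,\partial/\partial x^i$ of $\mathbb K[[x^1,\dots,x^n]]$, where $X^i=X(x^i)$; the bracket is the commutator and $\mathrm{ad}_X=[X,\cdot\,]$. For $k\in\mathbb Z$, let $X_{[k]}$ be the sum of the terms $c\,x^\alpha\,\partial/\partial x^i$ of $X$ with $\langle w,\alpha\rangle-w_i=k$, and let $\mathfrak X^{[k]}$ be the space of polynomial vector fields spanned by the $x^\alpha\,\partial/\partial x^i$ with $\langle w,\alpha\rangle-w_i=k$. Call $X$ $w$-admissible if it raises by $0$ the filtration of $\mathbb K[[x]]$ by the ideals $\mathcal F^d$ generated by the monomials $x^\alpha$ with $\langle w,\alpha\rangle\ge d$, that is, $X(\mathcal F^d)\subseteq\mathcal F^d$ for all $d$ (equivalently, $X_{[k]}=0$ for all $k<0$). Let $X$ be $w$-admissible. Let $(X_{[0]})_{\mathrm{lin}}$ be the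 usual linear part of $X_{[0]}$ (its terms with $|\alpha|=1$); for each integer $v$, it maps the space $V_v$ of linear forms spanned by the $x^i$ with $w_i=v$ to itself. Let $L$ be an extension field of $\mathbb K$ (for instance $\mathbb K$ itself, or a splitting field of the characteristic polynomial of $(X_{[0]})_{\mathrm{lin}}$ on the space of linear forms). A $w$-compatible ordering of the eigenvalues in $L$ is a vector $\lambda=(\lambda_1,\dots,\lambda_n)\in L^n$ such that, for every $v$, the $\lambda_i$ with $w_i=v$ are the eigenvalues of $(X_{[0]})_{\mathrm{lin}}|_{V_v}$, counted with algebraic multiplicity. For an integer $k\ge1$, call $X$ non-resonant of weighted degree $k$ if for some $w$-compatible ordering $\lambda$ of the eigenvalues in $L$ there is no pair $(i,\alpha)\in\{1,\dots,n\}\times\mathbb N^n$ with $\sum_j\lambda_j\alpha_j=\lambda_i$ and $\langle w,\alpha\rangle-w_i=k$. Call $X$ non-resonant with respect to $w$ if this holds for every $k\ge1$. Theorem. (1) If $k\ge1$ and $X$ is non-resonant of weighted degree $k$, then $\mathfrak X^{[k]}$ is finite-dimensional over $\mathbb K$ and $\mathrm{ad}_{X_{[0]}}$ maps $\mathfrak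 X^{[k]}$ bijectively onto itself. (2) If $X$ is non-resonant with respect to $w$, then there is a formal diffeomorphism $\varphi$, i.e. a $\mathbb K$-algebra automorphism of $\mathbb K[[x^1,\dots,x^n]]$, such that $\varphi^*X:=\varphi\circ X\circ\varphi^{-1}=X_{[0]}$. -/

import Mathlib

noncomputable section

namespace FormalVF

/-- The algebra `K[[x^1, …, x^n]]` of formal functions on `K^n`. -/
abbrev FormalFunction (K : Type*) [Field K] (n : ℕ) : Type _ := MvPowerSeries (Fin n) K

/-- A formal vector field on `K^n` is a `K`-linear derivation of `K[[x]]`. Its components are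
`X^i = X (x^i)`; its Lie bracket is the commutator of derivations. -/
abbrev FormalVectorField (K : Type*) [Field K] (n : ℕ) : Type _ :=
  Derivation K (FormalFunction K n) (FormalFunction K n)

/-- A formal diffeomorphism of `K^n` is a `K`-algebra automorphism of `K[[x]]`. -/
abbrev FormalDiffeomorphism (K : Type*) [Field K] (n : ℕ) : Type _ :=
  FormalFunction K n ≃ₐ[K] FormalFunction K n

variable {K : Type*} [Field K] {n : ℕ}

/-- The pullback `φ^* X = φ ∘ X ∘ φ⁻¹` of a formal vector field along a formal diffeomorphism. -/
def pullback (φ : FormalDiffeomorphism K n) (X : FormalVectorField K n) :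
    FormalVectorField K n :=
  Derivation.mk' (φ.toLinearMap ∘ₗ X.toLinearMap ∘ₗ φ.symm.toLinearMap) (by
    intro f g
    simp)

/-- A weighting of `K^n`: integers `1 ≤ w_1 ≤ w_2 ≤ ⋯ ≤ w_n`. -/
structure IsWeighting (w : Fin n → ℤ) : Prop where
  one_le : ∀ i, 1 ≤ w i
  monotone : Monotone w

/-- The ideal `F^d` of `K[[x]]` generated by the monomials `x^α` with `⟨w, α⟩ ≥ d`.
Here `Finsupp.weight w α = ∑ i, w_i α_i`. -/
def filtration (K : Type*) [Field K] {n : ℕ} (w : Fin n → ℤ) (d : ℤ) :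
    Ideal (FormalFunction K n) :=
  Ideal.span {f | ∃ α : Fin n →₀ ℕ, d ≤ Finsupp.weight w α ∧ f = MvPowerSeries.monomial α 1}

/-- The formal vector fields that raise filtration degree by `k`. -/
def vfFiltration (K : Type*) [Field K] {n : ℕ} (w : Fin n → ℤ) (k : ℤ) :
    Submodule (FormalFunction K n) (FormalVectorField K n) where
  carrier := {X | ∀ d : ℤ, ∀ f ∈ filtration K w d, X f ∈ filtration K w (d + k)}
  add_mem' hX hY d f hf := by
    simpa using Ideal.add_mem _ (hX d f hf) (hY d f hf)
  zero_mem' d f _ := by simp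
  smul_mem' g X hX d f hf := by
    simpa using Ideal.mul_mem_left _ g (hX d f hf)

/-- `X` is `w`-admissible: it lies in the degree-zero step of the filtration. -/
def IsAdmissible (w : Fin n → ℤ) (X : FormalVectorField K n) : Prop :=
  X ∈ vfFiltration K w 0

/-- The space `P^d` of quasi-homogeneous polynomials of weighted degree `d`, inside `K[[x]]`. -/
def quasiHom (K : Type*) [Field K] {n : ℕ} (w : Fin n → ℤ) (d : ℤ) :
    Submodule K (FormalFunction K n) :=
  (MvPolynomial.weightedHomogeneousSubmodule K w d).map
    (MvPolynomial.coeToMvPowerSeries.algHom K).toLinearMap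

/-- The space of quasi-homogeneous polynomial vector fields of weighted degree `k`: those which
raise the weighted degree of quasi-homogeneous polynomials by `k`. (For positive weights the
components `X (x^i)` of such a derivation are automatically polynomials.) -/
def vfGraded (K : Type*) [Field K] {n : ℕ} (w : Fin n → ℤ) (k : ℤ) :
    Submodule K (FormalVectorField K n) where
  carrier := {X | ∀ d : ℤ, ∀ f ∈ quasiHom K w d, X f ∈ quasiHom K w (d + k)}
  add_mem' hX hY d f hf := by
    simpa using Submodule.add_mem _ (hX d f hf) (hY d f hf)
  zero_mem' d f _ := by simp
  smul_mem' c X hX d f hf := by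
    simpa using Submodule.smul_mem _ c (hX d f hf)

/-- The part of weighted degree `d` of a formal power series: the terms with `⟨w, α⟩ = d`. -/
def seriesPart (w : Fin n → ℤ) (d : ℤ) (f : FormalFunction K n) : FormalFunction K n :=
  fun α => if Finsupp.weight w α = d then MvPowerSeries.coeff α f else 0

/-- The part `X_[k]` of weighted degree `k` of a formal vector field: its `i`-th component consists
of the terms `c x^α` of `X^i` with `⟨w, α⟩ - w_i = k`. -/
def vfPart (w : Fin n → ℤ) (k : ℤ) (X : FormalVectorField K n) : FormalVectorField K n :=
  ∑ i, seriesPart w (w i + k) (X (MvPowerSeries.X i)) • MvPowerSeries.pderiv K i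

/-- The weighted linear approximation `X_[0]`. -/
def weightedLin (w : Fin n → ℤ) (X : FormalVectorField K n) : FormalVectorField K n :=
  vfPart w 0 X

/-- The usual linear approximation `X_lin`, i.e. the one for the trivial weighting `(1, …, 1)`. -/
def usualLin (X : FormalVectorField K n) : FormalVectorField K n :=
  weightedLin (fun _ => 1) X

/-- The space of linear forms in those coordinates `x^i` whose weight is `v`. -/
def weightSpace (K : Type*) [Field K] {n : ℕ} (w : Fin n → ℤ) (v : ℤ) :
    Submodule K (FormalFunction K n) :=
  Submodule.span K ((fun i => MvPowerSeries.X i) '' {i : Fin n | w i = v})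

instance weightSpace_finite (w : Fin n → ℤ) (v : ℤ) : Module.Finite K (weightSpace K w v) :=
  Module.Finite.span_of_finite K ((Set.toFinite _).image _)

theorem vfPart_X (w : Fin n → ℤ) (k : ℤ) (X : FormalVectorField K n) (i : Fin n) :
    vfPart w k X (MvPowerSeries.X i) = seriesPart w (w i + k) (X (MvPowerSeries.X i)) := by
  have h : ∀ D : Fin n → FormalVectorField K n, (∑ j, D j) (MvPowerSeries.X i) =
      ∑ j, D j (MvPowerSeries.X i) := fun D => by
    rw [← Derivation.coeFnAddMonoidHom_apply, map_sum, Finset.sum_apply]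
    rfl
  rw [vfPart, h, Finset.sum_eq_single i]
  · simp [MvPowerSeries.pderiv_X_self]
  · intro j _ hj
    simp [MvPowerSeries.pderiv_X_of_ne hj.symm]
  · simp

theorem usualLin_weightedLin_mem (w : Fin n → ℤ) (X : FormalVectorField K n) (v : ℤ)
    (f : FormalFunction K n) (hf : f ∈ weightSpace K w v) :
    usualLin (weightedLin w X) f ∈ weightSpace K w v := by
  classical
  induction hf using Submodule.span_induction with
  | zero => simp
  | add f g _ _ hf hg => simpa using Submodule.add_mem _ hf hg
  | smul c f _ hf => simpa using Submodule.smul_mem _ c hf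
  | mem f hf =>
    obtain ⟨i, hi, rfl⟩ := hf
    have hi' : w i = v := hi
    have key : usualLin (weightedLin w X) (MvPowerSeries.X i) =
        ∑ j with w j = v, MvPowerSeries.coeff (Finsupp.single j 1) (X (MvPowerSeries.X i)) •
          (MvPowerSeries.X j : FormalFunction K n) := by
      rw [usualLin, weightedLin, vfPart_X, weightedLin, vfPart_X]
      ext α
      simp only [map_sum, MvPowerSeries.coeff_smul, MvPowerSeries.coeff_X]
      change (if Finsupp.weight (fun _ : Fin n => (1 : ℤ)) α = 1 + 0 then
        (if Finsupp.weight w α = w i + 0 then MvPowerSeries.coeff α (X (MvPowerSeries.X i)) else 0)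
        else 0) = _
      by_cases hα : ∃ j, α = Finsupp.single j 1
      · obtain ⟨j, rfl⟩ := hα
        simp [Finsupp.weight_single, Finsupp.single_left_inj, hi']
      · have h1 : ∀ j, α ≠ Finsupp.single j 1 := fun j hj => hα ⟨j, hj⟩
        have h2 : Finsupp.weight (fun _ : Fin n => (1 : ℤ)) α ≠ 1 + 0 := by
          intro h
          refine hα ((Finsupp.sum_eq_one_iff α).mp ?_)
          rw [Finsupp.weight_apply] at h
          simp only [Finsupp.sum, nsmul_eq_mul, mul_one, add_zero] at h ⊢
          exact_mod_cast h
        rw [if_neg h2]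
        simp [h1]
    rw [key]
    refine Submodule.sum_mem _ fun j hj => Submodule.smul_mem _ _ (Submodule.subset_span ?_)
    exact ⟨j, by simpa using hj, rfl⟩

/-- The restriction of `(X_[0])_lin` to the linear forms of weight `v`. -/
def weightSpaceAction (w : Fin n → ℤ) (X : FormalVectorField K n) (v : ℤ) :
    Module.End K (weightSpace K w v) :=
  (usualLin (weightedLin w X)).toLinearMap.restrict (usualLin_weightedLin_mem w X v)

/-- `lam` is a `w`-compatible ordering of the eigenvalues, in the extension field `L` of `K`, of
`(X_[0])_lin`: for every weight value `v`, the `lam i` with `w i = v` are the eigenvalues,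
counted with algebraic multiplicity, of the restriction of `(X_[0])_lin` to the linear forms of
weight `v`. Such an ordering exists in `L` iff the characteristic polynomial splits in `L`. -/
def IsCompatibleOrdering {L : Type*} [Field L] [Algebra K L] (w : Fin n → ℤ)
    (X : FormalVectorField K n) (lam : Fin n → L) : Prop :=
  ∀ v : ℤ, (weightSpaceAction w X v).charpoly.map (algebraMap K L) =
    ∏ i with w i = v, (Polynomial.X - Polynomial.C (lam i))

/-- The pair `(i, α)` is a resonance of `lam` with respect to `w`. -/
def IsResonance {L : Type*} [Field L] (w : Fin n → ℤ) (lam : Fin n → L) (i : Fin n)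
    (α : Fin n →₀ ℕ) : Prop :=
  ∑ j, lam j * (α j : L) = lam i ∧ w i < Finsupp.weight w α

/-- `X` is non-resonant of weighted degree `k`: some `w`-compatible ordering of the eigenvalues
(in the extension field `L`) has no resonance `(i, α)` of weighted degree `⟨w, α⟩ - w_i = k`. -/
def NonResonantOfDegree (L : Type*) [Field L] [Algebra K L] (w : Fin n → ℤ)
    (X : FormalVectorField K n) (k : ℤ) : Prop :=
  ∃ lam : Fin n → L, IsCompatibleOrdering w X lam ∧
    ¬ ∃ (i : Fin n) (α : Fin n →₀ ℕ), IsResonance w lam i α ∧ Finsupp.weight w α - w i = k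

/-- `X` is non-resonant with respect to `w`. -/
def NonResonant (L : Type*) [Field L] [Algebra K L] (w : Fin n → ℤ)
    (X : FormalVectorField K n) : Prop :=
  ∀ k : ℤ, 1 ≤ k → NonResonantOfDegree L w X k

end FormalVF

end

/-!
A formal vector field is determined by its components, so everything is checked on the coordinates
`x^i`; the error terms are controlled by the filtration `F^d`. This ideal consists of all series
whose terms have weight at least `d` (`coeff_eq_zero_of_mem_filtration`,
`mem_filtration_of_coeff`), so `K[[x]]` is separated and complete for it
(`eq_zero_of_forall_mem_filtration`, `exists_limit`), and the filtration degree of a linear map with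
a (twisted) Leibniz rule can be read off from its values on the coordinates
(`twisted_mem_filtration`).

Part (1). Since `vfGraded K w k` is finite-dimensional, it is enough that a quasi-homogeneous `Y` of
degree `k` commuting with `X_[0]` is zero (`eq_zero_of_lie_weightedLin_eq_zero`). Suppose that `Y`
kills all coordinates of weight less than `v`. On linear forms of weight `v`, the field `X_[0]` is
its linear part `A` plus polynomials in the coordinates of lower weight, so `Y` intertwines `A` with
the action of `X_[0]` on quasi-homogeneous polynomials of weight `v + k`. By Cayley–Hamilton
the characteristic polynomial of `A`, evaluated at `X_[0]`, kills the image of `Y`. Its roots are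
the `λ_i` with `w_i = v`, while the eigenvalues of `X_[0]` in weight `v + k` are among the sums
`∑ λ_j α_j` with `⟨w, α⟩ = v + k` (`hasSpectrumIn_of_mem_quasiHom`); non-resonance says that the two
sets are disjoint, so `Y` kills the linear forms of weight `v` as well. The description of the
eigenvalues follows because the spectra of a derivation add under multiplication. To
compare the spectra in the extension field `L`, it is enough to extend the scalars of `X_[0]`.

Part (2). If an endomorphism `E` of `K[[x]]`, equal to the identity to first order, satisfies
`E ∘ X = X_[0] ∘ E` up to terms of degree `k` and higher, then the degree `k` part of the defect is
`[X_[0], Y]` for some `Y` of degree `k` by part (1), and replacing `E (x^j)` by `E (x^j) + Y (x^j)`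
removes it (`NormalizesTo.exists_succ`). The images of the coordinates converge, the limit
intertwines `X` with `X_[0]` (`exists_normalizing_hom`, `hom_intertwines`), and it is
invertible by successive approximation (`hom_bijective`).
-/

noncomputable section

namespace FormalVF

open MvPowerSeries

variable {K : Type*} [Field K] {n : ℕ}

/-! ### Weights of exponents -/

theorem degree_le_weight {w : Fin n → ℤ} (hw : ∀ i, 1 ≤ w i) (α : Fin n →₀ ℕ) :
    (α.degree : ℤ) ≤ Finsupp.weight w α := by
  rw [Finsupp.degree_eq_sum, Finsupp.weight_eq_sum, Nat.cast_sum]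
  refine Finset.sum_le_sum fun i _ => ?_
  rw [nsmul_eq_mul]
  exact le_mul_of_one_le_right (by positivity) (hw i)

theorem weight_nonneg {w : Fin n → ℤ} (hw : ∀ i, 1 ≤ w i) (α : Fin n →₀ ℕ) :
    0 ≤ Finsupp.weight w α :=
  (Int.natCast_nonneg _).trans (degree_le_weight hw α)

theorem finite_weight_le {w : Fin n → ℤ} (hw : ∀ i, 1 ≤ w i) (d : ℤ) :
    {α : Fin n →₀ ℕ | Finsupp.weight w α ≤ d}.Finite := by
  refine (Finsupp.finite_of_degree_le (σ := Fin n) d.toNat).subset fun α hα => ?_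
  have h := degree_le_weight hw α
  have hα' : Finsupp.weight w α ≤ d := hα
  simp only [Set.mem_ofPred_eq]
  omega

theorem mem_span_monomial {S : Set (Fin n →₀ ℕ)} (f : FormalFunction K n) (hS : S.Finite)
    (hf : ∀ α, coeff α f ≠ 0 → α ∈ S) :
    f ∈ Submodule.span K ((fun α => (monomial α (1 : K) : FormalFunction K n)) '' S) := by
  classical
  have key : f = ∑ α ∈ hS.toFinset, coeff α f • (monomial α (1 : K) : FormalFunction K n) := by
    ext β
    simp only [map_sum, MvPowerSeries.coeff_smul, coeff_monomial, mul_ite, mul_one, mul_zero,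
      Finset.sum_ite_eq, Set.Finite.mem_toFinset]
    split_ifs with h
    · rfl
    · exact not_not.1 (mt (hf β) h)
  rw [key]
  refine Submodule.sum_mem _ fun α hα => Submodule.smul_mem _ _ (Submodule.subset_span ?_)
  exact ⟨α, by simpa using hα, rfl⟩

/-! ### The filtration by weighted order -/

theorem monomial_mem_filtration (w : Fin n → ℤ) {d : ℤ} {α : Fin n →₀ ℕ}
    (h : d ≤ Finsupp.weight w α) : (monomial α (1 : K)) ∈ filtration K w d :=
  Ideal.subset_span ⟨α, h, rfl⟩

theorem X_mem_filtration (w : Fin n → ℤ) (i : Fin n) :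
    (X i : FormalFunction K n) ∈ filtration K w (w i) :=
  monomial_mem_filtration w (by simp [Finsupp.weight_single])

theorem filtration_anti (w : Fin n → ℤ) {d e : ℤ} (h : d ≤ e) :
    filtration K w e ≤ filtration K w d :=
  Ideal.span_mono fun _ ⟨α, hα, hf⟩ => ⟨α, h.trans hα, hf⟩

theorem mem_filtration_of_nonpos (w : Fin n → ℤ) {d : ℤ} (h : d ≤ 0) (f : FormalFunction K n) :
    f ∈ filtration K w d := by
  have : (1 : FormalFunction K n) ∈ filtration K w d := by
    rw [← monomial_zero_one]
    exact monomial_mem_filtration w (by simpa using h)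
  rw [(Ideal.eq_top_iff_one _).2 this]
  trivial

theorem mul_mem_filtration (w : Fin n → ℤ) {d e : ℤ} {f g : FormalFunction K n}
    (hf : f ∈ filtration K w d) (hg : g ∈ filtration K w e) :
    f * g ∈ filtration K w (d + e) := by
  have h : filtration K w d * filtration K w e ≤ filtration K w (d + e) := by
    rw [filtration, filtration, Ideal.span_mul_span', filtration, Ideal.span_le]
    rintro _ ⟨_, ⟨α, hα, rfl⟩, _, ⟨β, hβ, rfl⟩, rfl⟩
    refine Ideal.subset_span ⟨α + β, ?_, ?_⟩
    · rw [map_add]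
      exact add_le_add hα hβ
    · simp [monomial_mul_monomial]
  exact h (Ideal.mul_mem_mul hf hg)

theorem coeff_eq_zero_of_mem_filtration {w : Fin n → ℤ} (hw : ∀ i, 1 ≤ w i) {d : ℤ}
    {f : FormalFunction K n} (hf : f ∈ filtration K w d) {α : Fin n →₀ ℕ}
    (hα : Finsupp.weight w α < d) : coeff α f = 0 := by
  classical
  refine Submodule.span_induction (p := fun f _ => ∀ α, Finsupp.weight w α < d → coeff α f = 0)
    ?_ (by simp) (fun f g _ _ hf hg α hα => by simp [hf α hα, hg α hα]) ?_ hf α hα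
  · rintro _ ⟨β, hβ, rfl⟩ α hα
    exact coeff_monomial_ne (by rintro rfl; omega) _
  · intro g f _ hf α hα
    rw [smul_eq_mul, coeff_mul]
    refine Finset.sum_eq_zero fun p hp => ?_
    rw [hf, mul_zero]
    have h1 := congrArg (Finsupp.weight w) (Finset.HasAntidiagonal.mem_antidiagonal.1 hp)
    rw [map_add] at h1
    have := weight_nonneg hw p.1
    omega

/-- The ideal `filtration K w d`, defined by monomial generators, contains every series all of whose
terms have weight at least `d`. Such a series of positive weighted order is a combination
`∑ x_i f_i`, where `f_i` collects the terms assigned to the variable `x_i`. -/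
theorem mem_filtration_of_coeff {w : Fin n → ℤ} (hw : ∀ i, 1 ≤ w i) {d : ℤ}
    {f : FormalFunction K n} (hf : ∀ α, Finsupp.weight w α < d → coeff α f = 0) :
    f ∈ filtration K w d := by
  classical
  suffices H : ∀ m : ℕ, ∀ d : ℤ, d ≤ m → ∀ f : FormalFunction K n,
      (∀ α, Finsupp.weight w α < d → coeff α f = 0) → f ∈ filtration K w d from
    H d.toNat d (by omega) f hf
  intro m
  induction m with
  | zero => exact fun d hd f _ => mem_filtration_of_nonpos w (by simpa using hd) f
  | succ m ih =>
    intro d hd f hf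
    rcases le_or_gt d 0 with hd0 | hd0
    · exact mem_filtration_of_nonpos w hd0 f
    have hex : ∀ α : Fin n →₀ ℕ, α ≠ 0 → ∃ i, α i ≠ 0 := fun α h => by
      by_contra! h'
      exact h (Finsupp.ext h')
    choose v hv using hex
    let g : Fin n → FormalFunction K n := fun i β =>
      if ∃ h : β + Finsupp.single i 1 ≠ 0, v _ h = i then coeff (β + Finsupp.single i 1) f else 0
    have hg : ∀ i β, coeff β (g i) =
      if ∃ h : β + Finsupp.single i 1 ≠ 0, v _ h = i then coeff (β + Finsupp.single i 1) f else 0 :=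
      fun i β => rfl
    have key : f = ∑ i, X i * g i := by
      ext α
      rw [map_sum]
      by_cases h0 : α = 0
      · subst h0
        rw [hf 0 (by simpa using hd0)]
        simp
      · rw [Finset.sum_eq_single (v α h0)]
        · have hα : α - Finsupp.single (v α h0) 1 + Finsupp.single (v α h0) 1 = α :=
            Finsupp.sub_add_single_one_cancel (hv α h0)
          rw [X_def, coeff_monomial_mul, if_pos (by simpa using Nat.one_le_iff_ne_zero.2 (hv α h0)),
            hg, one_mul]
          simp only [hα]
          rw [if_pos ⟨h0, trivial⟩]
        · intro i _ hi
          rw [X_def, coeff_monomial_mul, hg]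
          split_ifs with h1 h2
          · have hα : α - Finsupp.single i 1 + Finsupp.single i 1 = α :=
              tsub_add_cancel_of_le h1
            simp only [hα] at h2
            exact absurd h2.2.symm hi
          · simp
          · rfl
        · simp
    rw [key]
    refine Ideal.sum_mem _ fun i _ => ?_
    have : g i ∈ filtration K w (d - w i) := by
      refine ih _ (by have := hw i; push_cast at hd; omega) _ fun α hα => ?_
      rw [hg]
      split_ifs
      · refine hf _ ?_
        rw [map_add, Finsupp.weight_single, one_smul]
        omega
      · rfl
    simpa using mul_mem_filtration w (X_mem_filtration w i) this

theorem eq_zero_of_forall_mem_filtration {w : Fin n → ℤ} (hw : ∀ i, 1 ≤ w i) (d : ℤ)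
    {f : FormalFunction K n} (hf : ∀ m : ℕ, f ∈ filtration K w (d + m)) : f = 0 := by
  ext α
  exact coeff_eq_zero_of_mem_filtration hw (hf (Finsupp.weight w α - d + 1).toNat) (by omega)

/-- Completeness of `K[[x]]` for the filtration. -/
theorem exists_limit {w : Fin n → ℤ} (hw : ∀ i, 1 ≤ w i) (d : ℤ) (f : ℕ → FormalFunction K n)
    (hf : ∀ m : ℕ, f (m + 1) - f m ∈ filtration K w (d + m)) :
    ∃ g : FormalFunction K n, ∀ m : ℕ, g - f m ∈ filtration K w (d + m) := by
  have hcauchy : ∀ m l : ℕ, f (m + l) - f m ∈ filtration K w (d + m) := by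
    intro m l
    induction l with
    | zero => simp
    | succ l ih =>
      have := Ideal.add_mem _
        (filtration_anti w (by push_cast; omega : d + (m : ℤ) ≤ d + (m + l : ℕ)) (hf (m + l))) ih
      simpa [add_assoc] using this
  let N : (Fin n →₀ ℕ) → ℕ := fun α => (Finsupp.weight w α - d + 1).toNat
  let g : FormalFunction K n := fun α => coeff α (f (N α))
  refine ⟨g, fun m => mem_filtration_of_coeff hw fun α hα => ?_⟩
  have hN : N α ≤ m := by simp only [N]; omega
  have h := coeff_eq_zero_of_mem_filtration hw (hcauchy (N α) (m - N α))
    (α := α) (by simp only [N]; omega)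
  rw [Nat.add_sub_cancel' hN, map_sub, sub_eq_zero] at h
  rw [map_sub, h, sub_eq_zero]
  rfl

/-! ### Maps that raise the filtration -/

/-- A linear map of bounded filtration degree `-c` has filtration degree `k` as soon as it does on
monomials: the terms of large weight are controlled by the first property, and there are finitely
many others. -/
theorem map_mem_filtration_of_monomial {w : Fin n → ℤ} (hw : ∀ i, 1 ≤ w i) (c k : ℤ)
    (T : FormalFunction K n →ₗ[K] FormalFunction K n)
    (hT : ∀ d, ∀ f ∈ filtration K w d, T f ∈ filtration K w (d - c))
    (hm : ∀ α, T (monomial α 1) ∈ filtration K w (Finsupp.weight w α + k))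
    (d : ℤ) (f : FormalFunction K n) (hf : f ∈ filtration K w d) :
    T f ∈ filtration K w (d + k) := by
  classical
  let N : ℤ := d + k + c
  let r : FormalFunction K n := fun α => if N ≤ Finsupp.weight w α then coeff α f else 0
  have hr : ∀ α, coeff α r = if N ≤ Finsupp.weight w α then coeff α f else 0 := fun _ => rfl
  have hrN : r ∈ filtration K w N := mem_filtration_of_coeff hw fun α hα => by
    rw [hr, if_neg (by omega)]
  have hp : f - r ∈ Submodule.span K ((fun α => (monomial α (1 : K) : FormalFunction K n)) ''
      {α | d ≤ Finsupp.weight w α ∧ Finsupp.weight w α ≤ N}) := by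
    refine mem_span_monomial _ ((finite_weight_le hw N).subset fun α hα => hα.2) fun α hα => ?_
    rw [map_sub, hr] at hα
    constructor
    · by_contra h
      rw [coeff_eq_zero_of_mem_filtration hw hf (not_le.1 h)] at hα
      simp at hα
    · by_contra h
      rw [if_pos (by omega), sub_self] at hα
      exact hα rfl
  have hTp : T (f - r) ∈ filtration K w (d + k) := by
    have : Submodule.span K ((fun α => (monomial α (1 : K) : FormalFunction K n)) ''
      {α | d ≤ Finsupp.weight w α ∧ Finsupp.weight w α ≤ N}) ≤
        ((filtration K w (d + k)).restrictScalars K).comap T := by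
      rw [Submodule.span_le]
      rintro _ ⟨α, hα, rfl⟩
      exact filtration_anti w (by have := hα.1; omega) (hm α)
    exact this hp
  have hTr : T r ∈ filtration K w (d + k) := by
    have := hT _ _ hrN
    rwa [show N - c = d + k by simp only [N]; ring] at this
  have := Ideal.add_mem _ hTp hTr
  rwa [← map_add, sub_add_cancel] at this

/-- An induction principle: a property of exponents that holds for `0` and is inherited when one
variable is multiplied in. -/
theorem exponent_induction {P : (Fin n →₀ ℕ) → Prop} (h0 : P 0)
    (h1 : ∀ i α, P α → P (Finsupp.single i 1 + α)) (α : Fin n →₀ ℕ) : P α := by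
  induction α using Finsupp.induction with
  | zero => exact h0
  | single_add i m β _ _ hβ =>
    clear * - h1 hβ
    induction m with
    | zero => simpa using hβ
    | succ m ih =>
      rw [show Finsupp.single i (m + 1) + β = Finsupp.single i 1 + (Finsupp.single i m + β) by
        rw [add_comm m 1, Finsupp.single_add, add_assoc]]
      exact h1 i _ ih

theorem monomial_single_add (i : Fin n) (α : Fin n →₀ ℕ) :
    (monomial (Finsupp.single i 1 + α) (1 : K) : FormalFunction K n) = X i * monomial α 1 := by
  rw [X_def, monomial_mul_monomial, one_mul]

/-- Linear maps `T` with a Leibniz rule `T (fg) = T f · B g + A f · T g` along two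
filtration-preserving endomorphisms `A`, `B`; this covers derivations, differences of homomorphisms,
and the defect of a homomorphism to intertwine two derivations. The filtration degree of such a
map can be read off from its values on the coordinates. -/
theorem twisted_mem_filtration {w : Fin n → ℤ} (hw : ∀ i, 1 ≤ w i) (k : ℤ)
    (T A B : FormalFunction K n →ₗ[K] FormalFunction K n)
    (hA : ∀ d, ∀ f ∈ filtration K w d, A f ∈ filtration K w d)
    (hB : ∀ d, ∀ f ∈ filtration K w d, B f ∈ filtration K w d)
    (hT1 : T 1 = 0) (hTmul : ∀ f g, T (f * g) = T f * B g + A f * T g)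
    (hX : ∀ i, T (X i) ∈ filtration K w (w i + k))
    (d : ℤ) (f : FormalFunction K n) (hf : f ∈ filtration K w d) :
    T f ∈ filtration K w (d + k) := by
  have hmon : ∀ l, (∀ i, T (X i) ∈ filtration K w (w i + l)) →
      ∀ α, T (monomial α 1) ∈ filtration K w (Finsupp.weight w α + l) := by
    intro l hl α
    induction α using exponent_induction with
    | h0 =>
      rw [monomial_zero_one, hT1]
      exact Ideal.zero_mem _
    | h1 i α ih =>
      rw [monomial_single_add, hTmul, map_add, Finsupp.weight_single, one_smul]
      have ha := mul_mem_filtration w (hl i) (hB _ _ (monomial_mem_filtration (α := α) w le_rfl))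
      have hb := mul_mem_filtration w (hA _ _ (X_mem_filtration w i)) ih
      rw [show w i + Finsupp.weight w α + l = w i + l + Finsupp.weight w α by ring]
      refine Ideal.add_mem _ ha ?_
      rwa [show w i + l + Finsupp.weight w α = w i + (Finsupp.weight w α + l) by ring]
  -- The sum of the weights bounds how far `T` can lower the filtration.
  have hW : ∀ i, w i ≤ ∑ j, w j := fun i =>
    Finset.single_le_sum (f := w) (fun j _ => by linarith [hw j]) (Finset.mem_univ i)
  have hW0 : 0 ≤ ∑ j, w j := Finset.sum_nonneg fun j _ => by linarith [hw j]
  refine map_mem_filtration_of_monomial hw (∑ j, w j) k T ?_ (hmon k hX) d f hf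
  intro d f hf
  have hmon' := hmon (-∑ j, w j) fun i =>
    mem_filtration_of_nonpos w (by linarith [hW i]) _
  induction hf using Submodule.span_induction with
  | zero => simp
  | add f g _ _ hf hg => simpa using Ideal.add_mem _ hf hg
  | mem f hf =>
    obtain ⟨α, hα, rfl⟩ := hf
    exact filtration_anti w (by linarith) (hmon' α)
  | smul g f hf' hf =>
    rw [smul_eq_mul, hTmul]
    refine Ideal.add_mem _ (Ideal.mul_mem_left _ _ ?_) (Ideal.mul_mem_left _ _ hf)
    exact filtration_anti w (by linarith) (hB _ _ hf')

theorem derivation_mem_vfFiltration {w : Fin n → ℤ} (hw : ∀ i, 1 ≤ w i) {k : ℤ}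
    {Y : FormalVectorField K n} (hY : ∀ i, Y (X i) ∈ filtration K w (w i + k)) :
    Y ∈ vfFiltration K w k := fun d f hf =>
  twisted_mem_filtration hw k Y.toLinearMap LinearMap.id LinearMap.id (fun _ _ h => h)
    (fun _ _ h => h) (by simp) (fun f g => by simp [mul_comm, add_comm]) hY d f hf

/-- A formal vector field is determined by its components. -/
theorem vectorField_ext {Y Z : FormalVectorField K n} (h : ∀ i, Y (X i) = Z (X i)) : Y = Z := by
  have hw : ∀ i : Fin n, (1 : ℤ) ≤ (fun _ => (1 : ℤ)) i := fun _ => le_rfl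
  refine Derivation.ext fun f => sub_eq_zero.1 ?_
  refine eq_zero_of_forall_mem_filtration hw 0 fun m => ?_
  refine derivation_mem_vfFiltration (Y := Y - Z) hw (k := m) (fun i => ?_) 0 f
    (mem_filtration_of_nonpos _ le_rfl f)
  simp [h i]

/-- The vector field with prescribed components. -/
def ofComponents (c : Fin n → FormalFunction K n) : FormalVectorField K n :=
  ∑ i, c i • pderiv K i

theorem ofComponents_apply (c : Fin n → FormalFunction K n) (f : FormalFunction K n) :
    ofComponents c f = ∑ i, c i * pderiv K i f := by
  rw [ofComponents, ← Derivation.coeFnAddMonoidHom_apply, map_sum, Finset.sum_apply]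
  rfl

theorem ofComponents_X (c : Fin n → FormalFunction K n) (i : Fin n) :
    ofComponents c (X i) = c i := by
  classical
  rw [ofComponents_apply, Finset.sum_eq_single i]
  · simp
  · intro j _ hj
    simp [pderiv_X_of_ne hj.symm]
  · simp

theorem ofComponents_self (Y : FormalVectorField K n) : ofComponents (fun i => Y (X i)) = Y :=
  vectorField_ext fun i => ofComponents_X _ i

/-! ### Quasi-homogeneous polynomials and vector fields -/

theorem mem_quasiHom_iff {w : Fin n → ℤ} (hw : ∀ i, 1 ≤ w i) {d : ℤ} {f : FormalFunction K n} :
    f ∈ quasiHom K w d ↔ ∀ α, coeff α f ≠ 0 → Finsupp.weight w α = d := by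
  constructor
  · rintro ⟨p, hp, rfl⟩ α hα
    refine hp (d := α) ?_
    simpa using hα
  · intro hf
    have h := mem_span_monomial (S := {α | Finsupp.weight w α = d}) f
      ((finite_weight_le hw d).subset fun α hα => le_of_eq hα) hf
    refine (Submodule.span_le.2 ?_ : _ ≤ quasiHom K w d) h
    rintro _ ⟨α, hα, rfl⟩
    exact ⟨MvPolynomial.monomial α 1, MvPolynomial.isWeightedHomogeneous_monomial w α 1 hα,
      by simp⟩

theorem quasiHom_eq_span {w : Fin n → ℤ} (hw : ∀ i, 1 ≤ w i) (d : ℤ) :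
    quasiHom K w d = Submodule.span K ((fun α => (monomial α (1 : K) : FormalFunction K n)) ''
      {α | Finsupp.weight w α = d}) := by
  classical
  refine le_antisymm (fun f hf => mem_span_monomial f
    ((finite_weight_le hw d).subset fun α hα => le_of_eq hα) ((mem_quasiHom_iff hw).1 hf)) ?_
  rw [Submodule.span_le]
  rintro _ ⟨α, hα, rfl⟩
  refine (mem_quasiHom_iff hw).2 fun β hβ => ?_
  rw [coeff_monomial] at hβ
  by_cases h : β = α
  · exact h ▸ hα
  · simp [h] at hβ

theorem quasiHom_finiteDimensional {w : Fin n → ℤ} (hw : ∀ i, 1 ≤ w i) (d : ℤ) :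
    FiniteDimensional K (quasiHom K w d) := by
  rw [quasiHom_eq_span hw]
  exact FiniteDimensional.span_of_finite K
    (((finite_weight_le hw d).subset fun α hα => le_of_eq hα).image _)

theorem mul_mem_quasiHom (w : Fin n → ℤ) {d e : ℤ} {f g : FormalFunction K n}
    (hf : f ∈ quasiHom K w d) (hg : g ∈ quasiHom K w e) : f * g ∈ quasiHom K w (d + e) := by
  obtain ⟨p, hp, rfl⟩ := hf
  obtain ⟨q, hq, rfl⟩ := hg
  exact ⟨p * q, MvPolynomial.IsWeightedHomogeneous.mul hp hq, by simp⟩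

theorem monomial_mem_quasiHom {w : Fin n → ℤ} (hw : ∀ i, 1 ≤ w i) (α : Fin n →₀ ℕ) :
    (monomial α (1 : K)) ∈ quasiHom K w (Finsupp.weight w α) := by
  rw [quasiHom_eq_span hw]
  exact Submodule.subset_span ⟨α, rfl, rfl⟩

theorem X_mem_quasiHom {w : Fin n → ℤ} (hw : ∀ i, 1 ≤ w i) (i : Fin n) :
    (X i : FormalFunction K n) ∈ quasiHom K w (w i) := by
  simpa [Finsupp.weight_single, X_def] using
    monomial_mem_quasiHom (K := K) hw (Finsupp.single i 1)

theorem seriesPart_mem_quasiHom {w : Fin n → ℤ} (hw : ∀ i, 1 ≤ w i) (d : ℤ)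
    (f : FormalFunction K n) : seriesPart w d f ∈ quasiHom K w d := by
  refine (mem_quasiHom_iff hw).2 fun α hα => ?_
  by_contra h
  exact hα (if_neg h)

theorem quasiHom_le_filtration {w : Fin n → ℤ} (hw : ∀ i, 1 ≤ w i) {d : ℤ}
    {f : FormalFunction K n} (hf : f ∈ quasiHom K w d) : f ∈ filtration K w d := by
  refine mem_filtration_of_coeff hw fun α hα => ?_
  by_contra h
  exact hα.ne ((mem_quasiHom_iff hw).1 hf α h)

theorem mem_vfGraded_of_components {w : Fin n → ℤ} (hw : ∀ i, 1 ≤ w i) {k : ℤ}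
    {Y : FormalVectorField K n} (hY : ∀ i, Y (X i) ∈ quasiHom K w (w i + k)) :
    Y ∈ vfGraded K w k := by
  intro d f hf
  have hmon : ∀ α, Y (monomial α 1) ∈ quasiHom K w (Finsupp.weight w α + k) := by
    intro α
    induction α using exponent_induction with
    | h0 => simp [monomial_zero_one]
    | h1 i α ih =>
      rw [monomial_single_add, Derivation.leibniz, map_add, Finsupp.weight_single, one_smul]
      refine Submodule.add_mem _ ?_ ?_
      · rw [add_assoc]
        exact mul_mem_quasiHom w (X_mem_quasiHom hw i) ih
      · rw [show w i + Finsupp.weight w α + k = Finsupp.weight w α + (w i + k) by ring]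
        exact mul_mem_quasiHom w (monomial_mem_quasiHom hw α) (hY i)
  have : quasiHom K w d ≤ (quasiHom K w (d + k)).comap Y.toLinearMap := by
    rw [quasiHom_eq_span hw, Submodule.span_le]
    rintro _ ⟨α, rfl, rfl⟩
    exact hmon α
  exact this hf

theorem component_mem_quasiHom {w : Fin n → ℤ} (hw : ∀ i, 1 ≤ w i) {k : ℤ}
    {Y : FormalVectorField K n} (hY : Y ∈ vfGraded K w k) (i : Fin n) :
    Y (X i) ∈ quasiHom K w (w i + k) :=
  hY _ _ (X_mem_quasiHom hw i)

theorem vfGraded_finiteDimensional {w : Fin n → ℤ} (hw : ∀ i, 1 ≤ w i) (k : ℤ) :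
    FiniteDimensional K (vfGraded K w k) := by
  have := fun i => quasiHom_finiteDimensional (K := K) hw (w i + k)
  let T : vfGraded K w k →ₗ[K] (i : Fin n) → quasiHom K w (w i + k) :=
    { toFun := fun Y i => ⟨Y.1 (X i), component_mem_quasiHom hw Y.2 i⟩
      map_add' := fun Y Z => by ext; simp
      map_smul' := fun c Y => by ext; simp }
  refine FiniteDimensional.of_injective T fun Y Z h => Subtype.ext (vectorField_ext fun i => ?_)
  exact congrArg Subtype.val (congrFun h i)

theorem weightedLin_mem_vfGraded {w : Fin n → ℤ} (hw : ∀ i, 1 ≤ w i)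
    (Y : FormalVectorField K n) : weightedLin w Y ∈ vfGraded K w 0 :=
  mem_vfGraded_of_components hw fun i => by
    rw [weightedLin, vfPart_X]
    exact seriesPart_mem_quasiHom hw _ _

theorem lie_mem_vfGraded {w : Fin n → ℤ} {k : ℤ} {Y Z : FormalVectorField K n}
    (hY : Y ∈ vfGraded K w 0) (hZ : Z ∈ vfGraded K w k) : ⁅Y, Z⁆ ∈ vfGraded K w k := by
  intro d f hf
  rw [Derivation.commutator_apply]
  refine Submodule.sub_mem _ ?_ ?_
  · simpa using hY _ _ (hZ _ _ hf)
  · simpa using hZ _ _ (hY _ _ hf)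

/-! ### Vectors annihilated by a polynomial with prescribed roots -/

section Spectrum

variable {L V : Type*} [Field L]

theorem aeval_X_mul_apply [AddCommGroup V] [Module L V] (T : Module.End L V) (p : Polynomial L)
    (f : V) : Polynomial.aeval T (Polynomial.X * p) f = T (Polynomial.aeval T p f) := by
  rw [map_mul, Polynomial.aeval_X, Module.End.mul_apply]

theorem aeval_mul_X_apply [AddCommGroup V] [Module L V] (T : Module.End L V) (p : Polynomial L)
    (f : V) : Polynomial.aeval T (p * Polynomial.X) f = Polynomial.aeval T p (T f) := by
  rw [map_mul, Polynomial.aeval_X, Module.End.mul_apply]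

/-- `HasSpectrumIn D Λ f` says that some product of operators `D - a` with `a ∈ Λ` kills `f`,
i.e. that `f` is a sum of generalized eigenvectors of `D` with eigenvalues in `Λ`. -/
inductive HasSpectrumIn [AddCommGroup V] [Module L V] (D : V →ₗ[L] V) (Λ : Set L) : V → Prop
  | zero : HasSpectrumIn D Λ 0
  | step {a : L} {f : V} (ha : a ∈ Λ) (hf : HasSpectrumIn D Λ (D f - a • f)) :
      HasSpectrumIn D Λ f

namespace HasSpectrumIn

section Module

variable [AddCommGroup V] [Module L V] {D : V →ₗ[L] V} {Λ : Set L}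

theorem smul (c : L) {f : V} (hf : HasSpectrumIn D Λ f) : HasSpectrumIn D Λ (c • f) := by
  induction hf with
  | zero => simpa using zero
  | step ha _ ih =>
    refine step ha ?_
    rwa [map_smul, smul_comm _ c, ← smul_sub]

theorem map {f : V} (hf : HasSpectrumIn D Λ f) : HasSpectrumIn D Λ (D f) := by
  induction hf with
  | zero => simpa using zero
  | step ha _ ih =>
    refine step ha ?_
    rwa [map_sub, map_smul] at ih

theorem add {f g : V} (hf : HasSpectrumIn D Λ f) (hg : HasSpectrumIn D Λ g) :
    HasSpectrumIn D Λ (f + g) := by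
  induction hf generalizing g with
  | zero => simpa using hg
  | @step a f ha hf ih =>
    refine step ha ?_
    -- `(D - a) g` is again of the same kind, since `D` commutes with every `D - b`.
    have hg' : HasSpectrumIn D Λ (D g - a • g) := by
      clear ih
      induction hg with
      | zero => simpa using zero
      | @step b g hb _ ihg =>
        refine step hb ?_
        have : D (D g - a • g) - b • (D g - a • g) =
            D (D g - b • g) - a • (D g - b • g) := by
          simp only [map_sub, map_smul, smul_sub, smul_comm a b]
          abel
        rwa [this]
    have : D (f + g) - a • (f + g) = (D f - a • f) + (D g - a • g) := by
      rw [map_add, smul_add]; abel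
    rw [this]
    exact ih hg'

variable (D Λ) in
/-- The vectors with spectrum in `Λ`, as a submodule. -/
def submodule : Submodule L V where
  carrier := {f | HasSpectrumIn D Λ f}
  add_mem' := add
  zero_mem' := zero
  smul_mem' c _ := smul c

theorem eq_zero_of_eigenvector {f : V} (hf : HasSpectrumIn D Λ f) {c : L} (hc : c ∉ Λ)
    (h : D f - c • f = 0) : f = 0 := by
  induction hf with
  | zero => rfl
  | @step a f ha _ ih =>
    have h1 : D f = c • f := sub_eq_zero.1 h
    have h2 : D f - a • f = (c - a) • f := by rw [h1, sub_smul]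
    have h3 : D f - a • f = 0 := ih (by rw [h2, map_smul, h1, smul_comm c, sub_self])
    rw [h2, smul_eq_zero, sub_eq_zero] at h3
    rcases h3 with h3 | h3
    · exact absurd (h3 ▸ ha) hc
    · exact h3

theorem aeval_prod_insert {ι : Type*} [DecidableEq ι] {s : Finset ι} {j : ι} (hj : j ∉ s)
    (lam : ι → L) (f : V) :
    Polynomial.aeval D (∏ i ∈ insert j s, (Polynomial.X - Polynomial.C (lam i))) f =
      Polynomial.aeval D (∏ i ∈ s, (Polynomial.X - Polynomial.C (lam i)))
        (D f - lam j • f) := by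
  rw [Finset.prod_insert hj, mul_comm, map_mul, Module.End.mul_apply]
  simp

theorem of_aeval_prod {ι : Type*} (s : Finset ι) (lam : ι → L) (hs : ∀ i ∈ s, lam i ∈ Λ) {f : V}
    (hf : HasSpectrumIn D Λ
      (Polynomial.aeval D (∏ i ∈ s, (Polynomial.X - Polynomial.C (lam i))) f)) :
    HasSpectrumIn D Λ f := by
  classical
  induction s using Finset.induction_on generalizing f with
  | empty => simpa using hf
  | insert j s hj ih =>
    rw [aeval_prod_insert hj] at hf
    exact step (hs j (by simp)) (ih (fun i hi => hs i (by simp [hi])) hf)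

theorem eq_zero_of_aeval_prod {ι : Type*} (s : Finset ι) (lam : ι → L) (hs : ∀ i ∈ s, lam i ∉ Λ)
    {f : V} (hf : HasSpectrumIn D Λ f)
    (h : Polynomial.aeval D (∏ i ∈ s, (Polynomial.X - Polynomial.C (lam i))) f = 0) : f = 0 := by
  classical
  induction s using Finset.induction_on generalizing f with
  | empty => simpa using h
  | insert j s hj ih =>
    rw [aeval_prod_insert hj] at h
    refine hf.eq_zero_of_eigenvector (hs j (by simp))
      (ih (fun i hi => hs i (by simp [hi])) ?_ h)
    exact (submodule D Λ).sub_mem hf.map (hf.smul _)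

end Module

/-- For a derivation, spectra add under multiplication, because of
`(D - a - b) (fg) = (D - a) f · g + f · (D - b) g`. -/
theorem mul [CommRing V] [Algebra L V] {D : Derivation L V V} {Λ Μ Ν : Set L}
    (hadd : ∀ a ∈ Λ, ∀ b ∈ Μ, a + b ∈ Ν) {f g : V}
    (hf : HasSpectrumIn D.toLinearMap Λ f) (hg : HasSpectrumIn D.toLinearMap Μ g) :
    HasSpectrumIn D.toLinearMap Ν (f * g) := by
  induction hf generalizing g with
  | zero => simpa using zero
  | @step a f ha _ ihf =>
    induction hg with
    | zero => simpa using zero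
    | @step b g hb hg ihg =>
      refine step (hadd a ha b hb) ?_
      have : D.toLinearMap (f * g) - (a + b) • (f * g) =
          (D.toLinearMap f - a • f) * g + f * (D.toLinearMap g - b • g) := by
        simp only [Derivation.coeFn_coe, Derivation.leibniz, smul_eq_mul, Algebra.smul_def, map_add]
        ring
      rw [this]
      exact (ihf (step hb hg)).add ihg

end HasSpectrumIn

end Spectrum

/-! ### The spectrum of the weighted linear part on quasi-homogeneous polynomials -/

/-- The span of the monomials of weight `v` that only involve variables of weight less than `v`. -/
def decomposable (K : Type*) [Field K] {n : ℕ} (w : Fin n → ℤ) (v : ℤ) :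
    Submodule K (FormalFunction K n) :=
  Submodule.span K ((fun α => (monomial α (1 : K) : FormalFunction K n)) ''
    {α | Finsupp.weight w α = v ∧ ∀ j, α j ≠ 0 → w j < v})

/-- On linear forms of weight `v`, the vector field `X_[0]` agrees with its usual linear part up to
decomposable terms. -/
theorem weightedLin_sub_weightSpaceAction {w : Fin n → ℤ} (hw : ∀ i, 1 ≤ w i)
    (Y : FormalVectorField K n) (v : ℤ) (f : weightSpace K w v) :
    weightedLin w Y (f : FormalFunction K n) - (weightSpaceAction w Y v f : FormalFunction K n) ∈
      decomposable K w v := by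
  obtain ⟨f, hf⟩ := f
  change weightedLin w Y f - usualLin (weightedLin w Y) f ∈ decomposable K w v
  rw [← Derivation.sub_apply]
  have : weightSpace K w v ≤ (decomposable K w v).comap
      (weightedLin w Y - usualLin (weightedLin w Y)).toLinearMap := by
    rw [weightSpace, Submodule.span_le]
    rintro _ ⟨i, hi, rfl⟩
    have hi' : w i = v := hi
    change (weightedLin w Y - usualLin (weightedLin w Y)) (X i) ∈ decomposable K w v
    have hc : ∀ α, coeff α ((weightedLin w Y - usualLin (weightedLin w Y)) (X i)) ≠ 0 →
        Finsupp.weight w α = v ∧ Finsupp.weight (fun _ : Fin n => (1 : ℤ)) α ≠ 1 := by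
      intro α hα
      rw [Derivation.sub_apply, map_sub, usualLin, weightedLin, weightedLin, vfPart_X, vfPart_X,
        vfPart_X] at hα
      set g := seriesPart w (w i + 0) (Y (X i)) with hg
      have h1 : coeff α (seriesPart (fun _ : Fin n => (1 : ℤ)) (1 + 0) g) =
        if Finsupp.weight (fun _ : Fin n => (1 : ℤ)) α = 1 + 0 then coeff α g else 0 := rfl
      rw [h1] at hα
      constructor
      · rw [← hi', ← add_zero (w i)]
        refine (mem_quasiHom_iff hw).1 (seriesPart_mem_quasiHom hw (w i + 0) (Y (X i))) α ?_
        rw [← hg]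
        intro h0
        simp [h0] at hα
      · intro h
        simp [h] at hα
    refine mem_span_monomial _ ((finite_weight_le hw v).subset fun α hα => hα.1.le) ?_
    intro α hα
    obtain ⟨h1, h2⟩ := hc α hα
    refine ⟨h1, fun j hj => ?_⟩
    have hsplit : α - Finsupp.single j 1 + Finsupp.single j 1 = α :=
      Finsupp.sub_add_single_one_cancel hj
    have hne : α - Finsupp.single j 1 ≠ 0 := by
      intro h0
      rw [h0, zero_add] at hsplit
      rw [← hsplit, Finsupp.weight_single] at h2
      simp at h2
    have hpos : 0 < (α - Finsupp.single j 1).degree :=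
      Nat.pos_of_ne_zero (mt (Finsupp.degree_eq_zero_iff _).1 hne)
    have hle := degree_le_weight hw (α - Finsupp.single j 1)
    have hadd := Finsupp.weight_sub_single_add (w := w) hj
    omega
  exact this hf

theorem map_smul_algebraMap {L : Type*} [Field L] [Algebra K L] (c : K)
    (f : FormalFunction K n) :
    MvPowerSeries.map (algebraMap K L) (c • f) =
      algebraMap K L c • MvPowerSeries.map (algebraMap K L) f := by
  ext α
  rw [coeff_map, MvPowerSeries.coeff_smul, map_mul, MvPowerSeries.coeff_smul, coeff_map]

/-- The extension of scalars of a formal vector field. -/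
def extendScalars (L : Type*) [Field L] [Algebra K L] (Y : FormalVectorField K n) :
    FormalVectorField L n :=
  ofComponents fun i => MvPowerSeries.map (algebraMap K L) (Y (X i))

theorem extendScalars_map (L : Type*) [Field L] [Algebra K L] (Y : FormalVectorField K n)
    (f : FormalFunction K n) :
    extendScalars L Y (MvPowerSeries.map (algebraMap K L) f) =
      MvPowerSeries.map (algebraMap K L) (Y f) := by
  have hp : ∀ i, pderiv L i (MvPowerSeries.map (algebraMap K L) f) =
      MvPowerSeries.map (algebraMap K L) (pderiv K i f) := fun i => by
    ext α
    simp [coeff_pderiv]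
  conv_rhs => rw [← ofComponents_self Y]
  rw [extendScalars, ofComponents_apply, ofComponents_apply, map_sum]
  simp [hp]

theorem aeval_extendScalars_map (L : Type*) [Field L] [Algebra K L] (Y : FormalVectorField K n)
    (p : Polynomial K) (f : FormalFunction K n) :
    Polynomial.aeval (extendScalars L Y).toLinearMap (p.map (algebraMap K L))
        (MvPowerSeries.map (algebraMap K L) f) =
      MvPowerSeries.map (algebraMap K L) (Polynomial.aeval Y.toLinearMap p f) := by
  induction p using Polynomial.induction_on generalizing f with
  | C a => simp [map_smul_algebraMap]
  | add p q hp hq =>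
    rw [Polynomial.map_add, map_add, map_add, LinearMap.add_apply, LinearMap.add_apply, hp, hq,
      map_add]
  | monomial m a ih =>
    rw [pow_succ, ← mul_assoc, Polynomial.map_mul, Polynomial.map_X, aeval_mul_X_apply,
      aeval_mul_X_apply, Derivation.coeFn_coe, Derivation.coeFn_coe, extendScalars_map, ih]

/-- The values `∑ λ_j β_j` over the exponents `β` of weight `d`. -/
def weightedSums {L : Type*} [Field L] (w : Fin n → ℤ) (lam : Fin n → L) (d : ℤ) : Set L :=
  {c | ∃ β : Fin n →₀ ℕ, Finsupp.weight w β = d ∧ ∑ j, lam j * (β j : L) = c}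

theorem add_mem_weightedSums {L : Type*} [Field L] {w : Fin n → ℤ} {lam : Fin n → L} {d e : ℤ}
    {a b : L} (ha : a ∈ weightedSums w lam d) (hb : b ∈ weightedSums w lam e) :
    a + b ∈ weightedSums w lam (d + e) := by
  obtain ⟨β, rfl, rfl⟩ := ha
  obtain ⟨γ, rfl, rfl⟩ := hb
  exact ⟨β + γ, map_add _ _ _, by simp [mul_add, Finset.sum_add_distrib]⟩

theorem mem_weightedSums_self {L : Type*} [Field L] (w : Fin n → ℤ) (lam : Fin n → L)
    (i : Fin n) : lam i ∈ weightedSums w lam (w i) := by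
  classical
  refine ⟨Finsupp.single i 1, by simp [Finsupp.weight_single], ?_⟩
  simp [Finsupp.single_apply]

theorem hasSpectrumIn_monomial_of_variables {L : Type*} [Field L] {w : Fin n → ℤ}
    {lam : Fin n → L} {D : FormalVectorField L n} (α : Fin n →₀ ℕ)
    (h : ∀ j, α j ≠ 0 → HasSpectrumIn D.toLinearMap (weightedSums w lam (w j)) (X j)) :
    HasSpectrumIn D.toLinearMap (weightedSums w lam (Finsupp.weight w α)) (monomial α 1) := by
  induction α using exponent_induction with
  | h0 =>
    refine .step (a := 0) ⟨0, by simp, by simp⟩ ?_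
    rw [monomial_zero_one]
    simpa using HasSpectrumIn.zero
  | h1 i α ih =>
    rw [monomial_single_add, map_add, Finsupp.weight_single, one_smul]
    exact (h i (by simp)).mul (fun a ha b hb => add_mem_weightedSums ha hb)
      (ih fun j hj => h j (by simp [hj]))

/-- Over a field containing the eigenvalues, the coordinate `x^i` is a sum of generalized
eigenvectors of `X_[0]` with eigenvalues `∑ λ_j β_j`, `⟨w, β⟩ = w_i`. By induction on the weight:
the characteristic polynomial of the linear part on forms of weight `v = w_i`, evaluated at
`X_[0]`, maps `x^i` to decomposable terms, and its roots are the `λ_j` with `w_j = v`. -/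
theorem hasSpectrumIn_X {L : Type*} [Field L] [Algebra K L] {w : Fin n → ℤ}
    (hw : ∀ i, 1 ≤ w i) (Y : FormalVectorField K n) {lam : Fin n → L}
    (hlam : IsCompatibleOrdering w Y lam) (i : Fin n) :
    HasSpectrumIn (extendScalars L (weightedLin w Y)).toLinearMap
      (weightedSums w lam (w i)) (X i) := by
  suffices H : ∀ m : ℕ, ∀ i, w i ≤ m →
      HasSpectrumIn (extendScalars L (weightedLin w Y)).toLinearMap
        (weightedSums w lam (w i)) (X i) from
    H (w i).toNat i (by omega)
  intro m
  induction m with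
  | zero => exact fun i hi => absurd (hw i) (by push_cast at hi; omega)
  | succ m ih =>
    intro i hi
    set D := extendScalars L (weightedLin w Y) with hD
    set S := HasSpectrumIn.submodule D.toLinearMap (weightedSums w lam (w i)) with hS
    have hdec : ∀ f ∈ decomposable K w (w i), MvPowerSeries.map (algebraMap K L) f ∈ S := by
      intro f hf
      induction hf using Submodule.span_induction with
      | zero => simp
      | add f g _ _ hf hg => simpa using S.add_mem hf hg
      | smul c f _ hf =>
        rw [map_smul_algebraMap]
        exact S.smul_mem _ hf
      | mem f hf =>
        obtain ⟨α, ⟨hα, hlt⟩, rfl⟩ := hf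
        simp only [map_monomial, map_one]
        rw [hS, ← hα]
        exact hasSpectrumIn_monomial_of_variables α fun j hj =>
          ih j (by have := hlt j hj; push_cast at hi; omega)
    have hpoly : ∀ p : Polynomial K, ∀ f : weightSpace K w (w i),
        MvPowerSeries.map (algebraMap K L)
          (Polynomial.aeval (weightedLin w Y).toLinearMap p (f : FormalFunction K n)) -
        MvPowerSeries.map (algebraMap K L)
          (Polynomial.aeval (weightSpaceAction w Y (w i)) p f : weightSpace K w (w i)) ∈ S := by
      intro p
      induction p using Polynomial.induction_on with
      | C a => intro f; simp
      | add p q hp hq =>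
        intro f
        have := S.add_mem (hp f) (hq f)
        simp only [map_add, LinearMap.add_apply, Submodule.coe_add]
        convert this using 1
        abel
      | monomial m a ih =>
        intro f
        rw [pow_succ', mul_left_comm, aeval_X_mul_apply, aeval_X_mul_apply]
        set g := Polynomial.aeval (weightSpaceAction w Y (w i))
          (Polynomial.C a * Polynomial.X ^ m) f with hg
        set u := Polynomial.aeval (weightedLin w Y).toLinearMap
          (Polynomial.C a * Polynomial.X ^ m) (f : FormalFunction K n) with hu
        have h1 : D (MvPowerSeries.map (algebraMap K L) u -
            MvPowerSeries.map (algebraMap K L) (g : FormalFunction K n)) ∈ S :=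
          HasSpectrumIn.map (ih f)
        have h2 := hdec _ (weightedLin_sub_weightSpaceAction hw Y (w i) g)
        have := S.add_mem h1 h2
        rw [map_sub, hD, extendScalars_map, extendScalars_map, map_sub, sub_add_sub_cancel] at this
        exact this
    have hXi : (X i : FormalFunction K n) ∈ weightSpace K w (w i) :=
      Submodule.subset_span ⟨i, rfl, rfl⟩
    have h := hpoly (weightSpaceAction w Y (w i)).charpoly ⟨X i, hXi⟩
    rw [LinearMap.aeval_self_charpoly, LinearMap.zero_apply, Submodule.coe_zero, map_zero,
      sub_zero, ← aeval_extendScalars_map, hlam (w i), map_X] at h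
    refine HasSpectrumIn.of_aeval_prod _ lam (fun j hj => ?_) h
    have hj' : w j = w i := by simpa using hj
    exact hj' ▸ mem_weightedSums_self w lam j

theorem hasSpectrumIn_of_mem_quasiHom {L : Type*} [Field L] [Algebra K L] {w : Fin n → ℤ}
    (hw : ∀ i, 1 ≤ w i) (Y : FormalVectorField K n) {lam : Fin n → L}
    (hlam : IsCompatibleOrdering w Y lam) {d : ℤ} {f : FormalFunction K n}
    (hf : f ∈ quasiHom K w d) :
    HasSpectrumIn (extendScalars L (weightedLin w Y)).toLinearMap (weightedSums w lam d)
      (MvPowerSeries.map (algebraMap K L) f) := by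
  rw [quasiHom_eq_span hw] at hf
  induction hf using Submodule.span_induction with
  | zero => simpa using HasSpectrumIn.zero
  | add f g _ _ hf hg => simpa using hf.add hg
  | smul c f _ hf =>
    rw [map_smul_algebraMap]
    exact hf.smul _
  | mem f hf =>
    obtain ⟨α, rfl, rfl⟩ := hf
    simp only [map_monomial, map_one]
    exact hasSpectrumIn_monomial_of_variables α fun j _ => hasSpectrumIn_X hw Y hlam j

/-! ### The homological operator -/

theorem derivation_monomial_eq_zero {Y : FormalVectorField K n} (α : Fin n →₀ ℕ)
    (h : ∀ j, α j ≠ 0 → Y (X j) = 0) : Y (monomial α 1) = 0 := by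
  induction α using exponent_induction with
  | h0 => simp [monomial_zero_one]
  | h1 i α ih =>
    rw [monomial_single_add, Derivation.leibniz, h i (by simp), ih fun j hj => h j (by simp [hj])]
    simp

/-- A quasi-homogeneous vector field `Y` of degree `k` that commutes with `X_[0]` vanishes if there
are no resonances of degree `k`. By induction on the weight `v`, `Y` kills all variables of lower
weight, so it intertwines the linear part on forms of weight `v` with the action of `X_[0]` on
`P^(v + k)`; these two have disjoint spectra. -/
theorem eq_zero_of_lie_weightedLin_eq_zero {L : Type*} [Field L] [Algebra K L] {w : Fin n → ℤ}
    (hw : ∀ i, 1 ≤ w i) (Z : FormalVectorField K n) {k : ℤ} (hk : 1 ≤ k)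
    (hres : NonResonantOfDegree L w Z k) {Y : FormalVectorField K n} (hY : Y ∈ vfGraded K w k)
    (hcomm : ⁅weightedLin w Z, Y⁆ = 0) : Y = 0 := by
  obtain ⟨lam, hlam, hnr⟩ := hres
  have hYZ : ∀ f, weightedLin w Z (Y f) = Y (weightedLin w Z f) := fun f => by
    have := DFunLike.congr_fun hcomm f
    rwa [Derivation.commutator_apply, Derivation.zero_apply, sub_eq_zero] at this
  suffices H : ∀ m : ℕ, ∀ i, w i ≤ m → Y (X i) = 0 from
    vectorField_ext fun i => by simpa using H (w i).toNat i (by omega)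
  intro m
  induction m with
  | zero => exact fun i hi => absurd (hw i) (by push_cast at hi; omega)
  | succ m ih =>
    intro i hi
    have hdec : ∀ f ∈ decomposable K w (w i), Y f = 0 := by
      intro f hf
      induction hf using Submodule.span_induction with
      | zero => simp
      | add f g _ _ hf hg => simp [hf, hg]
      | smul c f _ hf => simp [hf]
      | mem f hf =>
        obtain ⟨α, ⟨_, hlt⟩, rfl⟩ := hf
        exact derivation_monomial_eq_zero α fun j hj =>
          ih j (by have := hlt j hj; push_cast at hi; omega)
    have hint : ∀ f : weightSpace K w (w i),
        weightedLin w Z (Y (f : FormalFunction K n)) =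
          Y (weightSpaceAction w Z (w i) f : FormalFunction K n) := fun f => by
      have := hdec _ (weightedLin_sub_weightSpaceAction hw Z (w i) f)
      rw [hYZ]
      rwa [map_sub, sub_eq_zero] at this
    have hpoly : ∀ p : Polynomial K, ∀ f : weightSpace K w (w i),
        Polynomial.aeval (weightedLin w Z).toLinearMap p (Y (f : FormalFunction K n)) =
          Y (Polynomial.aeval (weightSpaceAction w Z (w i)) p f : weightSpace K w (w i)) := by
      intro p
      induction p using Polynomial.induction_on with
      | C a => intro f; simp
      | add p q hp hq => intro f; simp [hp, hq]
      | monomial m a ih =>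
        intro f
        rw [pow_succ, ← mul_assoc, aeval_mul_X_apply, aeval_mul_X_apply, Derivation.coeFn_coe,
          hint, ih]
    have hXi : (X i : FormalFunction K n) ∈ weightSpace K w (w i) :=
      Submodule.subset_span ⟨i, rfl, rfl⟩
    have h := hpoly (weightSpaceAction w Z (w i)).charpoly ⟨X i, hXi⟩
    rw [LinearMap.aeval_self_charpoly, LinearMap.zero_apply, Submodule.coe_zero, map_zero] at h
    have hspec := hasSpectrumIn_of_mem_quasiHom hw Z hlam (component_mem_quasiHom hw hY i)
    have h0 := hspec.eq_zero_of_aeval_prod {j | w j = w i} lam ?_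
      (by rw [← hlam (w i), aeval_extendScalars_map, h, map_zero])
    · ext α
      have := congrArg (coeff α) h0
      simpa using this
    · rintro j hj ⟨β, hβ, hsum⟩
      have hj' : w j = w i := by simpa using hj
      exact hnr ⟨j, β, ⟨hsum, by omega⟩, by omega⟩

theorem bijOn_ad_weightedLin {L : Type*} [Field L] [Algebra K L] {w : Fin n → ℤ}
    (hw : ∀ i, 1 ≤ w i) (Z : FormalVectorField K n) {k : ℤ} (hk : 1 ≤ k)
    (hres : NonResonantOfDegree L w Z k) :
    Set.BijOn (LieAlgebra.ad K (FormalVectorField K n) (weightedLin w Z))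
      (vfGraded K w k) (vfGraded K w k) := by
  have := vfGraded_finiteDimensional (K := K) hw k
  have hmaps : ∀ Y ∈ vfGraded K w k,
      LieAlgebra.ad K (FormalVectorField K n) (weightedLin w Z) Y ∈ vfGraded K w k :=
    fun Y hY => lie_mem_vfGraded (weightedLin_mem_vfGraded hw Z) hY
  let T := (LieAlgebra.ad K (FormalVectorField K n) (weightedLin w Z)).restrict hmaps
  have hT : Function.Injective T := by
    rw [injective_iff_map_eq_zero]
    intro Y hY
    exact Subtype.ext (eq_zero_of_lie_weightedLin_eq_zero hw Z hk hres Y.2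
      (congrArg Subtype.val hY))
  have hT' : Function.Surjective T := LinearMap.injective_iff_surjective.1 hT
  refine ⟨hmaps, fun Y hY Y' hY' h => ?_, fun Y hY => ?_⟩
  · exact congrArg Subtype.val (@hT ⟨Y, hY⟩ ⟨Y', hY'⟩ (Subtype.ext h))
  · obtain ⟨Y', h⟩ := hT' ⟨Y, hY⟩
    exact ⟨Y', Y'.2, congrArg Subtype.val h⟩

/-! ### Endomorphisms of the algebra of formal functions -/

theorem hom_mem_filtration {w : Fin n → ℤ} {E : FormalFunction K n →ₐ[K] FormalFunction K n}
    (hE : ∀ j, E (X j) ∈ filtration K w (w j)) (d : ℤ) (f : FormalFunction K n)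
    (hf : f ∈ filtration K w d) : E f ∈ filtration K w d := by
  have hmon : ∀ α, E (monomial α 1) ∈ filtration K w (Finsupp.weight w α) := by
    intro α
    induction α using exponent_induction with
    | h0 => exact mem_filtration_of_nonpos w (by simp) _
    | h1 i α ih =>
      rw [monomial_single_add, map_mul, map_add, Finsupp.weight_single, one_smul]
      exact mul_mem_filtration w (hE i) ih
  induction hf using Submodule.span_induction with
  | zero => simp
  | add f g _ _ hf hg => simpa using Ideal.add_mem _ hf hg
  | smul g f _ hf => simpa using Ideal.mul_mem_left _ _ hf
  | mem f hf =>
    obtain ⟨α, hα, rfl⟩ := hf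
    exact filtration_anti w hα (hmon α)

/-- An endomorphism that is the identity to first order on the coordinates preserves the weight of
each coordinate. -/
theorem hom_X_mem_filtration {w : Fin n → ℤ} {E : FormalFunction K n →ₐ[K] FormalFunction K n}
    (hE : ∀ j, E (X j) - X j ∈ filtration K w (w j + 1)) (j : Fin n) :
    E (X j) ∈ filtration K w (w j) := by
  have := Ideal.add_mem _ (filtration_anti w (by omega) (hE j)) (X_mem_filtration (K := K) w j)
  simpa using this

theorem hom_sub_mem_filtration {w : Fin n → ℤ} (hw : ∀ i, 1 ≤ w i) (k : ℤ)
    {E E' : FormalFunction K n →ₐ[K] FormalFunction K n}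
    (hE : ∀ j, E (X j) ∈ filtration K w (w j)) (hE' : ∀ j, E' (X j) ∈ filtration K w (w j))
    (h : ∀ j, E' (X j) - E (X j) ∈ filtration K w (w j + k)) {d : ℤ} {f : FormalFunction K n}
    (hf : f ∈ filtration K w d) : E' f - E f ∈ filtration K w (d + k) :=
  twisted_mem_filtration hw k (E'.toLinearMap - E.toLinearMap) E.toLinearMap E'.toLinearMap
    (hom_mem_filtration hE) (hom_mem_filtration hE') (by simp)
    (fun f g => by simp only [LinearMap.sub_apply, AlgHom.toLinearMap_apply, map_mul]; ring)
    h d f hf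

/-- If two endomorphisms that are the identity to first order differ on the coordinates by a
vector field `Y` of filtration degree `k ≥ 1`, then they differ by `Y` to leading order. -/
theorem hom_sub_sub_mem_filtration {w : Fin n → ℤ} (hw : ∀ i, 1 ≤ w i) {k : ℤ} (hk : 1 ≤ k)
    {E E' : FormalFunction K n →ₐ[K] FormalFunction K n} {Y : FormalVectorField K n}
    (hE : ∀ j, E (X j) - X j ∈ filtration K w (w j + 1)) (hY : Y ∈ vfFiltration K w k)
    (h : ∀ j, E' (X j) = E (X j) + Y (X j)) {d : ℤ} {f : FormalFunction K n}
    (hf : f ∈ filtration K w d) : E' f - E f - Y f ∈ filtration K w (d + (k + 1)) := by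
  have hYX : ∀ j, Y (X j) ∈ filtration K w (w j + k) := fun j => hY _ _ (X_mem_filtration w j)
  have hE' : ∀ j, E' (X j) - X j ∈ filtration K w (w j + 1) := fun j => by
    have := Ideal.add_mem _ (hE j) (filtration_anti w (by omega) (hYX j))
    rwa [sub_add_eq_add_sub, ← h j] at this
  have hid : ∀ j, AlgHom.id K (FormalFunction K n) (X j) ∈ filtration K w (w j) :=
    fun j => X_mem_filtration w j
  have hdiff : ∀ d, ∀ f ∈ filtration K w d, E' f - E f ∈ filtration K w (d + k) :=
    fun d f hf => hom_sub_mem_filtration hw k (hom_X_mem_filtration hE) (hom_X_mem_filtration hE')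
      (fun j => by rw [h j, add_sub_cancel_left]; exact hYX j) hf
  refine map_mem_filtration_of_monomial hw (-k) (k + 1)
    (E'.toLinearMap - E.toLinearMap - Y.toLinearMap) (fun d f hf => ?_) (fun α => ?_) d f hf
  · rw [sub_neg_eq_add]
    exact Ideal.sub_mem _ (hdiff d f hf) (hY d f hf)
  · change E' _ - E _ - Y _ ∈ _
    induction α using exponent_induction with
    | h0 => simp [monomial_zero_one]
    | h1 i α ih =>
      have hα := monomial_mem_filtration (K := K) (α := α) w le_rfl
      rw [monomial_single_add, map_add, Finsupp.weight_single, one_smul]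
      set g : FormalFunction K n := monomial α 1 with hg
      have key : E' (X i * g) - E (X i * g) - Y (X i * g) =
          Y (X i) * (E' g - g) + E (X i) * (E' g - E g - Y g) + (E (X i) - X i) * Y g := by
        rw [map_mul, map_mul, h i, Derivation.leibniz, smul_eq_mul, smul_eq_mul]
        ring
      rw [key]
      refine Ideal.add_mem _ (Ideal.add_mem _ ?_ ?_) ?_
      · have := mul_mem_filtration w (hYX i)
          (hom_sub_mem_filtration hw 1 hid (hom_X_mem_filtration hE') hE' hα)
        exact filtration_anti w (by omega) this
      · have := mul_mem_filtration w (hom_X_mem_filtration hE i) ih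
        exact filtration_anti w (by omega) this
      · have := mul_mem_filtration w (hE i) (hY _ _ hα)
        exact filtration_anti w (by omega) this

theorem exists_hom {w : Fin n → ℤ} (hw : ∀ i, 1 ≤ w i) (a : Fin n → FormalFunction K n)
    (ha : ∀ j, a j ∈ filtration K w (w j)) :
    ∃ E : FormalFunction K n →ₐ[K] FormalFunction K n, ∀ j, E (X j) = a j := by
  have hs : HasSubst a := hasSubst_of_constantCoeff_zero fun j =>
    coeff_eq_zero_of_mem_filtration hw (ha j) (by rw [map_zero]; linarith [hw j])
  exact ⟨substAlgHom hs, fun j => substAlgHom_X hs j⟩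

/-- An endomorphism that is the identity to first order is bijective: the equation `E g = h` is
solved by successive approximation. -/
theorem hom_bijective {w : Fin n → ℤ} (hw : ∀ i, 1 ≤ w i)
    {E : FormalFunction K n →ₐ[K] FormalFunction K n}
    (hE : ∀ j, E (X j) - X j ∈ filtration K w (w j + 1)) : Function.Bijective E := by
  have hid : ∀ j, AlgHom.id K (FormalFunction K n) (X j) ∈ filtration K w (w j) :=
    fun j => X_mem_filtration w j
  have hE1 : ∀ d, ∀ f ∈ filtration K w d, E f - f ∈ filtration K w (d + 1) := fun d f hf =>
    hom_sub_mem_filtration hw 1 hid (hom_X_mem_filtration hE) hE hf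
  constructor
  · rw [injective_iff_map_eq_zero]
    intro f hf
    refine eq_zero_of_forall_mem_filtration hw 0 fun m => ?_
    induction m with
    | zero => exact mem_filtration_of_nonpos w (by simp) f
    | succ m ih =>
      have := hE1 _ _ ih
      rw [hf, zero_sub, neg_mem_iff] at this
      simpa [add_assoc] using this
  · intro h
    let g : ℕ → FormalFunction K n := fun m => Nat.rec 0 (fun _ g => g + (h - E g)) m
    have hg : ∀ m, g (m + 1) = g m + (h - E (g m)) := fun m => rfl
    have herr : ∀ m : ℕ, h - E (g m) ∈ filtration K w (0 + m) := by
      intro m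
      induction m with
      | zero => exact mem_filtration_of_nonpos w (by simp) _
      | succ m ih =>
        have := neg_mem (hE1 _ _ ih)
        have heq : h - E (g (m + 1)) = -(E (h - E (g m)) - (h - E (g m))) := by
          rw [hg, map_add]; ring
        rw [heq]
        simpa [add_assoc] using this
    obtain ⟨f, hf⟩ := exists_limit hw 0 g fun m => by
      rw [hg, add_sub_cancel_left]
      exact herr m
    refine ⟨f, (sub_eq_zero.1 (eq_zero_of_forall_mem_filtration hw 0 fun m => ?_)).symm⟩
    have h1 := hom_mem_filtration (hom_X_mem_filtration hE) _ _ (hf m)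
    have heq : h - E f = (h - E (g m)) - E (f - g m) := by rw [map_sub]; ring
    rw [heq]
    exact Ideal.sub_mem _ (herr m) h1

/-! ### The normal form -/

theorem sub_seriesPart_mem_filtration {w : Fin n → ℤ} (hw : ∀ i, 1 ≤ w i) {d : ℤ}
    {f : FormalFunction K n} (hf : f ∈ filtration K w d) :
    f - seriesPart w d f ∈ filtration K w (d + 1) := by
  refine mem_filtration_of_coeff hw fun α hα => ?_
  have hc : coeff α (seriesPart w d f) = if Finsupp.weight w α = d then coeff α f else 0 := rfl
  rw [map_sub, hc]
  split_ifs with h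
  · exact sub_self _
  · rw [coeff_eq_zero_of_mem_filtration hw hf (by omega), sub_zero]

theorem vfGraded_le_vfFiltration {w : Fin n → ℤ} (hw : ∀ i, 1 ≤ w i) {k : ℤ}
    {Y : FormalVectorField K n} (hY : Y ∈ vfGraded K w k) : Y ∈ vfFiltration K w k :=
  derivation_mem_vfFiltration hw fun i =>
    quasiHom_le_filtration hw (component_mem_quasiHom hw hY i)

/-- An admissible vector field differs from its weighted linear part by a field of filtration
degree one. -/
theorem sub_weightedLin_X_mem_filtration {w : Fin n → ℤ} (hw : ∀ i, 1 ≤ w i)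
    {Z : FormalVectorField K n} (hZ : IsAdmissible w Z) (i : Fin n) :
    Z (X i) - weightedLin w Z (X i) ∈ filtration K w (w i + 1) := by
  rw [weightedLin, vfPart_X]
  simpa using sub_seriesPart_mem_filtration hw (hZ _ _ (X_mem_filtration w i))

/-- `NormalizesTo w Z m E` says that the endomorphism `E` is the identity to first order and that
it intertwines `Z` with its weighted linear part on the coordinates up to terms of weighted degree
greater than `m`. -/
structure NormalizesTo (w : Fin n → ℤ) (Z : FormalVectorField K n) (m : ℕ)
    (E : FormalFunction K n →ₐ[K] FormalFunction K n) : Prop where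
  sub_mem : ∀ j, E (X j) - X j ∈ filtration K w (w j + 1)
  defect_mem : ∀ i, E (Z (X i)) - weightedLin w Z (E (X i)) ∈ filtration K w (w i + (m + 1))

/-- One step of the normalization: the leading part of the defect of `E`, viewed as a vector field
of degree `m + 1`, is `[X_[0], Y]` for some `Y`, and adding `Y` to `E` on the coordinates
removes it. -/
theorem NormalizesTo.exists_succ {w : Fin n → ℤ} (hw : ∀ i, 1 ≤ w i)
    {Z : FormalVectorField K n} (hZ : IsAdmissible w Z) {m : ℕ}
    (hbij : Set.BijOn (LieAlgebra.ad K (FormalVectorField K n) (weightedLin w Z))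
      (vfGraded K w (m + 1)) (vfGraded K w (m + 1)))
    {E : FormalFunction K n →ₐ[K] FormalFunction K n} (hE : NormalizesTo w Z m E) :
    ∃ E', NormalizesTo w Z (m + 1) E' ∧
      ∀ j, E' (X j) - E (X j) ∈ filtration K w (w j + 1 + m) := by
  let δ : Fin n → FormalFunction K n := fun i => E (Z (X i)) - weightedLin w Z (E (X i))
  let W : FormalVectorField K n := ofComponents fun i => seriesPart w (w i + (m + 1)) (δ i)
  have hWX : ∀ i, W (X i) = seriesPart w (w i + (m + 1)) (δ i) := fun i => ofComponents_X _ i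
  have hW : W ∈ vfGraded K w (m + 1) := mem_vfGraded_of_components hw fun i => by
    rw [hWX]
    exact seriesPart_mem_quasiHom hw _ _
  obtain ⟨Y, hY, hYW⟩ := hbij.surjOn hW
  have hYf := vfGraded_le_vfFiltration hw hY
  have hYX : ∀ j, Y (X j) ∈ filtration K w (w j + (m + 1)) := fun j =>
    hYf _ _ (X_mem_filtration w j)
  have hsub : ∀ j, E (X j) + Y (X j) - X j ∈ filtration K w (w j + 1) := fun j => by
    have := Ideal.add_mem _ (hE.sub_mem j) (filtration_anti w (by omega) (hYX j))
    rwa [sub_add_eq_add_sub] at this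
  obtain ⟨E', hE'⟩ := exists_hom hw (fun j => E (X j) + Y (X j)) fun j => by
    have := Ideal.add_mem _ (filtration_anti w (by omega) (hsub j)) (X_mem_filtration (K := K) w j)
    simpa using this
  refine ⟨E', ⟨fun j => by rw [hE']; exact hsub j, fun i => ?_⟩, fun j => ?_⟩
  · have hZX : Z (X i) ∈ filtration K w (w i) := by simpa using hZ _ _ (X_mem_filtration w i)
    have h1 := hom_sub_sub_mem_filtration hw (by omega) hE.sub_mem hYf hE' hZX
    have h2 := hYf _ _ (sub_weightedLin_X_mem_filtration hw hZ i)
    have h3 := sub_seriesPart_mem_filtration hw (hE.defect_mem i)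
    have h4 : W (X i) = weightedLin w Z (Y (X i)) - Y (weightedLin w Z (X i)) := by
      rw [← hYW, LieAlgebra.ad_apply, Derivation.commutator_apply]
    have hsum := Ideal.add_mem _ (Ideal.add_mem _ h1 (filtration_anti w (by omega) h2))
      (filtration_anti w (by omega) h3)
    have key : E' (Z (X i)) - weightedLin w Z (E' (X i)) =
        E' (Z (X i)) - E (Z (X i)) - Y (Z (X i)) + Y (Z (X i) - weightedLin w Z (X i)) +
          (δ i - seriesPart w (w i + (m + 1)) (δ i)) := by
      rw [← hWX, h4, hE', map_add, map_sub]
      simp only [δ]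
      ring
    rw [key]
    push_cast
    exact hsum
  · rw [hE', add_sub_cancel_left]
    exact filtration_anti w (by omega) (hYX j)

/-- The normalizing endomorphism, as the limit of the successive normalizations. -/
theorem exists_normalizing_hom {w : Fin n → ℤ} (hw : ∀ i, 1 ≤ w i)
    {Z : FormalVectorField K n} (hZ : IsAdmissible w Z)
    (hbij : ∀ m : ℕ, Set.BijOn (LieAlgebra.ad K (FormalVectorField K n) (weightedLin w Z))
      (vfGraded K w (m + 1)) (vfGraded K w (m + 1))) :
    ∃ E : FormalFunction K n →ₐ[K] FormalFunction K n,
      (∀ j, E (X j) - X j ∈ filtration K w (w j + 1)) ∧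
        ∀ i, E (Z (X i)) = weightedLin w Z (E (X i)) := by
  have h0 : NormalizesTo w Z 0 (AlgHom.id K _) :=
    ⟨fun j => by simp, fun i => by simpa using sub_weightedLin_X_mem_filtration hw hZ i⟩
  choose next hnext hclose using
    fun (m : ℕ) (E : {E // NormalizesTo w Z m E}) => E.2.exists_succ hw hZ (hbij m)
  let s : (m : ℕ) → {E // NormalizesTo w Z m E} := fun m =>
    Nat.rec ⟨AlgHom.id K _, h0⟩ (fun m E => ⟨next m E, hnext m E⟩) m
  have hs : ∀ (m : ℕ) (j : Fin n), (s (m + 1)).1 (X j) - (s m).1 (X j) ∈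
      filtration K w (w j + 1 + m) := fun m j => hclose m (s m) j
  choose a ha using fun j => exists_limit hw (w j + 1) (fun m => (s m).1 (X j)) fun m => hs m j
  have haX : ∀ j, a j - X j ∈ filtration K w (w j + 1) := fun j => by
    have := Ideal.add_mem _ (ha j 0) (filtration_anti w (by simp) ((s 0).2.sub_mem j))
    rw [sub_add_sub_cancel] at this
    simpa using this
  obtain ⟨E, hE⟩ := exists_hom hw a fun j => by
    have := Ideal.add_mem _ (filtration_anti w (by omega) (haX j)) (X_mem_filtration (K := K) w j)
    simpa using this
  have hEX : ∀ j, E (X j) - X j ∈ filtration K w (w j + 1) := fun j => by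
    rw [hE]; exact haX j
  refine ⟨E, hEX, fun i => sub_eq_zero.1 (eq_zero_of_forall_mem_filtration hw (w i + 1)
    fun m => ?_)⟩
  have hZX : Z (X i) ∈ filtration K w (w i) := by simpa using hZ _ _ (X_mem_filtration w i)
  have h1 : E (Z (X i)) - (s m).1 (Z (X i)) ∈ filtration K w (w i + (1 + m)) :=
    hom_sub_mem_filtration hw (1 + m)
    (hom_X_mem_filtration (s m).2.sub_mem) (hom_X_mem_filtration hEX)
    (fun j => by rw [hE, ← add_assoc]; exact ha j m) hZX
  have h2 := (s m).2.defect_mem i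
  have h3 := vfGraded_le_vfFiltration hw (weightedLin_mem_vfGraded hw Z) _ _ (ha i m)
  have key : E (Z (X i)) - weightedLin w Z (E (X i)) =
      (E (Z (X i)) - (s m).1 (Z (X i))) +
        ((s m).1 (Z (X i)) - weightedLin w Z ((s m).1 (X i))) -
          weightedLin w Z (a i - (s m).1 (X i)) := by
    rw [map_sub, hE]
    ring
  rw [key]
  refine Ideal.sub_mem _ (Ideal.add_mem _ ?_ ?_) ?_
  · exact filtration_anti w (by omega) h1
  · exact filtration_anti w (by omega) h2
  · exact filtration_anti w (by omega) h3

/-- An endomorphism that intertwines two vector fields on the coordinates intertwines them. -/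
theorem hom_intertwines {w : Fin n → ℤ} (hw : ∀ i, 1 ≤ w i)
    {E : FormalFunction K n →ₐ[K] FormalFunction K n}
    (hE : ∀ j, E (X j) ∈ filtration K w (w j)) {Y Z : FormalVectorField K n}
    (h : ∀ i, E (Y (X i)) = Z (E (X i))) (f : FormalFunction K n) : E (Y f) = Z (E f) := by
  refine sub_eq_zero.1 (eq_zero_of_forall_mem_filtration hw 0 fun m => ?_)
  refine twisted_mem_filtration hw m
    (E.toLinearMap ∘ₗ Y.toLinearMap - Z.toLinearMap ∘ₗ E.toLinearMap) E.toLinearMap E.toLinearMap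
    (hom_mem_filtration hE) (hom_mem_filtration hE) (by simp) (fun f g => ?_) (fun i => ?_) 0 f
    (mem_filtration_of_nonpos w le_rfl f)
  · simp only [LinearMap.sub_apply, LinearMap.comp_apply, AlgHom.toLinearMap_apply,
      Derivation.coeFn_coe, Derivation.leibniz, smul_eq_mul, map_mul, map_add]
    ring
  · simp [h i]

end FormalVF

end

theorem theorem4p5 {K : Type*} [Field K] [CharZero K] {L : Type*} [Field L] [Algebra K L]
    {n : ℕ} (w : Fin n → ℤ) (hw : FormalVF.IsWeighting w)
    (X : FormalVF.FormalVectorField K n) (hX : FormalVF.IsAdmissible w X) :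
    (∀ k : ℤ, 1 ≤ k → FormalVF.NonResonantOfDegree L w X k →
      FiniteDimensional K (FormalVF.vfGraded K w k) ∧
      Set.BijOn (LieAlgebra.ad K (FormalVF.FormalVectorField K n) (FormalVF.weightedLin w X))
        (FormalVF.vfGraded K w k) (FormalVF.vfGraded K w k)) ∧
    (FormalVF.NonResonant L w X →
      ∃ φ : FormalVF.FormalDiffeomorphism K n,
        FormalVF.pullback φ X = FormalVF.weightedLin w X) := by
  refine ⟨fun k hk hres => ⟨FormalVF.vfGraded_finiteDimensional hw.one_le k,
    FormalVF.bijOn_ad_weightedLin hw.one_le X hk hres⟩, fun hres => ?_⟩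
  obtain ⟨E, hE, hEX⟩ := FormalVF.exists_normalizing_hom hw.one_le hX fun m =>
    FormalVF.bijOn_ad_weightedLin hw.one_le X (by omega) (hres (m + 1) (by omega))
  refine ⟨AlgEquiv.ofBijective E (FormalVF.hom_bijective hw.one_le hE), Derivation.ext fun f => ?_⟩
  set φ := AlgEquiv.ofBijective E (FormalVF.hom_bijective hw.one_le hE)
  have h := FormalVF.hom_intertwines hw.one_le (FormalVF.hom_X_mem_filtration hE) hEX (φ.symm f)
  have hf : E (φ.symm f) = f := φ.apply_symm_apply f
  rw [hf] at h
  exact h
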